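/- Let $\mathscr{A}=\mathscr{A}_{1,0}\cup\mathscr{A}_{1,1}\cup\mathscr{A}_2\cup\mathscr{A}_3$ be the following set of activation functions $\varrho:\mathbb{R}\to\mathbb{R}$. * $\varrho\in\mathscr{A}_{1,k}$ ($k\in\mathbb{N}$) if there are $a_0<x_0<b_0$ such that $\varrho\in C^k((a_0,b_0))$ and the one-sided limits $\lim_{t\to0^-}\frac{\varrho^{(k)}(x_0+t)-\varrho^{(k)}(x_0)}{t}$ and $\lim_{t\to0^+}\frac{\varrho^{(k)}(x_0+t)-\varrho^{(k)}(x_0)}{t}$ exist in $\mathbb{R}$ and are different. * $\mathscr{S}$ is the set of bounded functions $h:\mathbb{R}\to\mathbb{R}$ whose limits at $-\infty$ and $+\infty$ exist in $\mathbb{R}$ and are different; $\varrho\in\mathscr{A}_2$ if $\varrho(x)=(x+b_0)\,h(x)+b_1$ for all $x\in\mathbb{R}$, for some $b_0,b_1\in\mathbb{R}$ and $h\in\mathscr{S}$. * $\varrho\in\mathscr{A}_3$ if $\varrho\in\mathscr{S}$ and there is $x_0\in\mathbb{R}$ at which $\varrho''(x_0)$ exists and is nonzero. For $N,L,d,n\in\mathbb{N}^+$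 let $\mathcal{NN}_\varrho\{N,L;\mathbb{R}^d\to\mathbb{R}^n\}$ be the set of maps $\mathcal{L}_{L'}\circ\varrho\circ\mathcal{L}_{L'-1}\circ\cdots\circ\varrho\circ\mathcal{L}_0$, where $1\le L'\le L$, $\varrho$ acts elementwise, and $\mathcal{L}_\ell:\mathbb{R}^{N_\ell}\to\mathbb{R}^{N_{\ell+1}}$ is affine with $N_0=d$, $N_{L'+1}=n$ and $1\le N_\ell\le N$ for $1\le\ell\le L'$ (networks of width at most $N$ and at most $L$ hidden layers). A continuous function $f:\mathbb{R}^d\to\mathbb{R}$ is called continuous piecewise linear with $q$ pieces if $\mathbb{R}^d$ is the union of $q$ closed convex sets on each of which $f$ is affine. **Corollary.** Suppose $\varrho\in\mathscr{A}$ and let $f:\mathbb{R}^d\to\mathbb{R}$ be a continuous piecewise linear function with $q$ pieces, where $d,q\in\mathbb{N}^+$. Then for any $\varepsilon>0$ and $A>0$ there exists $$\phi\in\mathcal{NN}_\varrho\big\{3\lceil 3q/2\rceil q,\;4\lceil\log_2 q\rceil+2;\;\mathbb{R}^d\to\mathbb{R}\big\}$$ such that $|\phi(x)-f(x)|<\varepsilon$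 for all $x\in[-A,A]^d$. -/

import Mathlib

open Set Filter Topology

/-- `x₀` is a `k`-th order kink of `ρ`: near `x₀` the function is of class `C^k`, and the left and
right derivatives of `ρ^(k)` at `x₀` exist (as real numbers) and are different. -/
def IsKink (k : ℕ) (ρ : ℝ → ℝ) (x₀ : ℝ) : Prop :=
  ∃ a₀ b₀ : ℝ, a₀ < x₀ ∧ x₀ < b₀ ∧ ContDiffOn ℝ (k : WithTop ℕ∞) ρ (Ioo a₀ b₀) ∧
    ∃ l r : ℝ, l ≠ r ∧
      Tendsto (fun t : ℝ => (iteratedDeriv k ρ (x₀ + t) - iteratedDeriv k ρ x₀) / t)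
        (𝓝[<] 0) (𝓝 l) ∧
      Tendsto (fun t : ℝ => (iteratedDeriv k ρ (x₀ + t) - iteratedDeriv k ρ x₀) / t)
        (𝓝[>] 0) (𝓝 r)

/-- The class `𝒜_{1,k}`: functions with at least one `k`-th order kink. -/
def ActA1 (k : ℕ) : Set (ℝ → ℝ) := {ρ | ∃ x₀ : ℝ, IsKink k ρ x₀}

/-- The class `𝒮` of S-shaped functions: bounded, with different finite limits at `-∞` and `+∞`. -/
def SShaped : Set (ℝ → ℝ) :=
  {h | BddAbove (range fun x : ℝ => |h x|) ∧
    ∃ l r : ℝ, l ≠ r ∧ Tendsto h atBot (𝓝 l) ∧ Tendsto h atTop (𝓝 r)}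

/-- The class `𝒜₂`: functions of the form `ρ(x) = (x + b₀) h(x) + b₁` with `h` S-shaped. -/
def ActA2 : Set (ℝ → ℝ) :=
  {ρ | ∃ b₀ b₁ : ℝ, ∃ h ∈ SShaped, ∀ x : ℝ, ρ x = (x + b₀) * h x + b₁}

/-- The class `𝒜₃`: S-shaped functions whose second derivative exists and is nonzero at some point.
Existence of `ρ''(x₀)` means: `ρ` is differentiable near `x₀`, and its derivative is differentiable
at `x₀` (the latter follows from `deriv (deriv ρ) x₀ ≠ 0`). -/
def ActA3 : Set (ℝ → ℝ) :=
  {ρ | ρ ∈ SShaped ∧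
    ∃ x₀ : ℝ, (∀ᶠ x in 𝓝 x₀, DifferentiableAt ℝ ρ x) ∧ deriv (deriv ρ) x₀ ≠ 0}

/-- The activation function set `𝒜 = 𝒜_{1,0} ∪ 𝒜_{1,1} ∪ 𝒜₂ ∪ 𝒜₃`. -/
def ActA : Set (ℝ → ℝ) := (ActA1 0 ∪ ActA1 1) ∪ ActA2 ∪ ActA3

/-- `IsRealized ρ N n L d φ`: the map `φ : ℝ^d → ℝ^n` is realized by a fully connected
`ρ`-activated network with exactly `L` hidden layers, each of which has between `1` and `N` neurons,
that is, `φ = 𝓛_L ∘ ρ ∘ 𝓛_{L-1} ∘ ⋯ ∘ ρ ∘ 𝓛_0` with affine maps `𝓛_ℓ y = W_ℓ y + b_ℓ`.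
The recursion peels off the first layer. -/
def IsRealized (ρ : ℝ → ℝ) (N n : ℕ) :
    (L d : ℕ) → ((Fin d → ℝ) → (Fin n → ℝ)) → Prop
  | 0, d, φ =>
      ∃ (W : Matrix (Fin n) (Fin d) ℝ) (b : Fin n → ℝ), ∀ x, φ x = W.mulVec x + b
  | L + 1, d, φ =>
      ∃ m : ℕ, 1 ≤ m ∧ m ≤ N ∧
        ∃ (W : Matrix (Fin m) (Fin d) ℝ) (b : Fin m → ℝ) (ψ : (Fin m → ℝ) → (Fin n → ℝ)),
          IsRealized ρ N n L m ψ ∧ ∀ x, φ x = ψ (fun i => ρ ((W.mulVec x + b) i))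

/-- Maps `ℝ^d → ℝ^n` realized by `ρ`-activated networks of width at most `N` and depth (number of
hidden layers, at least one) at most `L`. -/
def NNet (ρ : ℝ → ℝ) (N L d n : ℕ) : Set ((Fin d → ℝ) → (Fin n → ℝ)) :=
  {φ | ∃ L' : ℕ, 1 ≤ L' ∧ L' ≤ L ∧ IsRealized ρ N n L' d φ}

/-- `f : ℝ^d → ℝ` is a continuous piecewise linear function with `q` pieces: it is continuous and
`ℝ^d` is the union of `q` closed convex sets on each of which `f` is affine. The sets may overlap
and need not be optimally chosen, so that this holds for every `q` that is at least the smallest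
number of pieces of `f`. -/
def IsCPWL {d : ℕ} (f : (Fin d → ℝ) → ℝ) (q : ℕ) : Prop :=
  Continuous f ∧
    ∃ X : Fin q → Set (Fin d → ℝ),
      (⋃ i, X i) = univ ∧
      ∀ i, IsClosed (X i) ∧ Convex ℝ (X i) ∧
        ∃ g : (Fin d → ℝ) →ᵃ[ℝ] ℝ, EqOn f g (X i)

/-!
The proof joins three facts.

*Piecewise linear functions are max-min functions, approximately.* Let `f` be affine on each of the
closed convex sets `X i`, `i < q`, which cover the space, and intersect them with the given cube.
For each pair `(i, j)` the Hahn-Banach theorem yields an affine function `h i j` that lies above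
`f - ε` on `X i` and below `f + ε` on `X j` (`exists_affine_between`): the graphs of `f` over the two
sets, moved apart by `2 * ε`, are disjoint compact convex sets. Then `⨅ j, h i j` is at least `f - ε`
on `X i` and at most `f + ε` everywhere on the cube, so that `⨆ i, ⨅ j, h i j` is within `ε` of `f`
(`IsCPWL.exists_iSup_iInf`). The functions `h i j` need not be affine components of `f`. A max-min
of components, with the `i`-th minimum over the components that dominate `f` on `X i`, can fail to
equal `f` for an arbitrary convex cover.

*ReLU networks compute the max-min of a `q × q` table.* A layer of ReLU neurons halves the length of
every row by taking minima of adjacent entries, with three neurons for a pair and two for a single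
entry, hence `⌈3 * q / 2⌉` neurons for a row of length `q` (`ScalarNet.relu_iSup_iInf`). One extra
layer covers the case `q = 1`, where at least one hidden layer is still required.

*Each ReLU neuron can be replaced by a small `ρ`-network*, of width three and depth one or two, up to
a uniformly small error on a compact set (`exists_approxRelu`, `ApproxRelu.exists_scalarNet`). A kink
of `ρ`, a kink of `deriv ρ` seen through difference quotients, or the behaviour of `x * h x` at large
scales, give a function that is linear with different slopes on both sides of `0`; subtracting a
multiple of the identity leaves the ReLU function. For S-shaped `ρ` the ReLU function is the product
of `x` and a step function; a mixed second difference of `ρ` at a point with `ρ'' ≠ 0` computes the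
product.
-/

/-! ### Networks with arbitrary finite index types -/

theorem AffineMap.apply_eq_linear_add {E F : Type*} [AddCommGroup E] [Module ℝ E] [AddCommGroup F]
    [Module ℝ F] (T : E →ᵃ[ℝ] F) (x : E) : T x = T.linear x + T 0 := by
  simpa using T.map_vadd 0 x

theorem AffineMap.continuous_of_pi {ι F : Type*} [Finite ι] [AddCommGroup F] [Module ℝ F]
    [TopologicalSpace F] [ContinuousAdd F] [ContinuousSMul ℝ F] (T : (ι → ℝ) →ᵃ[ℝ] F) :
    Continuous T := by
  rw [funext T.apply_eq_linear_add]
  exact T.linear.continuous_on_pi.add continuous_const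

/-- `ScalarNet ρ N L ι φ`: the map `φ : (ι → ℝ) → ℝ` is realized by a `ρ`-network with exactly `L`
hidden layers of at most `N` neurons each. Unlike in `IsRealized`, the neurons of a hidden layer may
be indexed by an arbitrary nonempty finite type, and the affine maps are not given by matrices. -/
inductive ScalarNet (ρ : ℝ → ℝ) (N : ℕ) : ℕ → (ι : Type) → ((ι → ℝ) → ℝ) → Prop
  | affine {ι : Type} (T : (ι → ℝ) →ᵃ[ℝ] ℝ) : ScalarNet ρ N 0 ι T
  | layer {L : ℕ} {ι κ : Type} [Fintype κ] [Nonempty κ] (hκ : Fintype.card κ ≤ N)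
      (T : (ι → ℝ) →ᵃ[ℝ] (κ → ℝ)) {ψ : (κ → ℝ) → ℝ} (hψ : ScalarNet ρ N L κ ψ) :
      ScalarNet ρ N (L + 1) ι (fun x => ψ fun k => ρ (T x k))

namespace ScalarNet

variable {ρ : ℝ → ℝ} {N L : ℕ} {ι κ : Type}

theorem comp_affine {ψ : (κ → ℝ) → ℝ} (hψ : ScalarNet ρ N L κ ψ)
    (T : (ι → ℝ) →ᵃ[ℝ] (κ → ℝ)) : ScalarNet ρ N L ι (fun x => ψ (T x)) := by
  cases hψ with
  | affine S => exact .affine (S.comp T)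
  | layer hκ S hψ => exact .layer hκ (S.comp T) hψ

theorem congr {φ ψ : (ι → ℝ) → ℝ} (hψ : ScalarNet ρ N L ι ψ) (h : ∀ x, φ x = ψ x) :
    ScalarNet ρ N L ι φ := by
  rwa [funext h]

theorem continuous [hι : Finite ι] {φ : (ι → ℝ) → ℝ} (hρ : Continuous ρ) (hφ : ScalarNet ρ N L ι φ) :
    Continuous φ := by
  revert hι
  induction hφ with
  | affine T => exact T.continuous_of_pi
  | layer hκ T hψ ih =>
    intro _
    have hT := T.continuous_of_pi
    exact ih.comp (continuous_pi fun k => hρ.comp ((continuous_apply k).comp hT))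

end ScalarNet

theorem AffineMap.exists_mulVec_add {n d : ℕ} (T : (Fin d → ℝ) →ᵃ[ℝ] (Fin n → ℝ)) :
    ∃ (W : Matrix (Fin n) (Fin d) ℝ) (b : Fin n → ℝ), ∀ x, T x = W.mulVec x + b := by
  refine ⟨LinearMap.toMatrix' T.linear, T 0, fun x => ?_⟩
  rw [T.apply_eq_linear_add, ← Matrix.toLin'_apply, Matrix.toLin'_toMatrix']

/-- Enumerating the index types turns a `ScalarNet` into a network in the sense of `IsRealized`. -/
theorem ScalarNet.isRealized {ρ : ℝ → ℝ} {N L : ℕ} {ι : Type} {φ : (ι → ℝ) → ℝ}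
    (hφ : ScalarNet ρ N L ι φ) {d : ℕ} (e : ι ≃ Fin d) :
    IsRealized ρ N 1 L d (fun x _ => φ fun i => x (e i)) := by
  induction hφ generalizing d with
  | affine T =>
    obtain ⟨W, b, h⟩ := AffineMap.exists_mulVec_add
      ((AffineMap.pi fun _ : Fin 1 => T).comp (LinearMap.funLeft ℝ ℝ e).toAffineMap)
    exact ⟨W, b, fun x => (h x).symm ▸ rfl⟩
  | @layer L ι κ _ _ hκ T ψ hψ ih =>
    have e' := Fintype.equivFin κ
    obtain ⟨W, b, h⟩ := AffineMap.exists_mulVec_add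
      ((LinearMap.funLeft ℝ ℝ e'.symm).toAffineMap.comp
        (T.comp (LinearMap.funLeft ℝ ℝ e).toAffineMap))
    refine ⟨Fintype.card κ, Fintype.card_pos, hκ, W, b, _, ih e', fun x => ?_⟩
    rw [← h x]
    funext _
    simp [LinearMap.funLeft, Function.comp_def]

/-! ### Minima and maxima by ReLU networks -/

/-- One layer of ReLU neurons replaces the columns of a table by the minima of adjacent columns
(a last unpaired column is kept), by means of the identities `t = max t 0 - max (-t) 0` and
`min s t = s - max (s - t) 0`. -/
theorem ScalarNet.relu_min_adjacent {N L n : ℕ} {ι : Type} [Fintype ι] [Nonempty ι] (hn : 0 < n)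
    (hN : Fintype.card ι * ((3 * n + 1) / 2) ≤ N) {ψ : (ι × Fin ((n + 1) / 2) → ℝ) → ℝ}
    (hψ : ScalarNet (fun t => max t 0) N L (ι × Fin ((n + 1) / 2)) ψ) :
    ScalarNet (fun t => max t 0) N (L + 1) (ι × Fin n) (fun a => ψ fun p =>
      if h : 2 * (p.2 : ℕ) + 1 < n then
        min (a (p.1, ⟨2 * p.2, by omega⟩)) (a (p.1, ⟨2 * p.2 + 1, h⟩))
      else a (p.1, ⟨2 * p.2, by omega⟩)) := by
  let κ := ι × ((Fin ((n + 1) / 2) × Bool) ⊕ Fin (n / 2))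
  have : NeZero ((n + 1) / 2) := ⟨by omega⟩
  let S : (ι × Fin n → ℝ) →ₗ[ℝ] (κ → ℝ) :=
    { toFun := fun a k => match k with
        | (i, .inl (j, true)) => a (i, ⟨2 * j, by omega⟩)
        | (i, .inl (j, false)) => -a (i, ⟨2 * j, by omega⟩)
        | (i, .inr j) => a (i, ⟨2 * j, by omega⟩) - a (i, ⟨2 * j + 1, by omega⟩)
      map_add' := by
        intro a b; ext ⟨i, ⟨j, _ | _⟩ | j⟩ <;> simp <;> ring
      map_smul' := by
        intro c a; ext ⟨i, ⟨j, _ | _⟩ | j⟩ <;> simp; ring }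
  let T : (κ → ℝ) →ₗ[ℝ] (ι × Fin ((n + 1) / 2) → ℝ) :=
    { toFun := fun z p => z (p.1, .inl (p.2, true)) - z (p.1, .inl (p.2, false)) -
        if h : 2 * (p.2 : ℕ) + 1 < n then z (p.1, .inr ⟨p.2, by omega⟩) else 0
      map_add' := by
        intro a b; ext ⟨i, j⟩; by_cases h : 2 * (j : ℕ) + 1 < n <;> simp [h] <;> ring
      map_smul' := by
        intro c a; ext ⟨i, j⟩; by_cases h : 2 * (j : ℕ) + 1 < n <;> simp [h] <;> ring }
  have hcard : Fintype.card κ ≤ N := by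
    refine le_trans (le_of_eq ?_) hN
    simp only [κ, Fintype.card_prod, Fintype.card_sum, Fintype.card_fin, Fintype.card_bool]
    congr 1
    rcases Nat.even_or_odd' n with ⟨m, rfl | rfl⟩ <;> omega
  refine (ScalarNet.layer hcard S.toAffineMap (hψ.comp_affine T.toAffineMap)).congr fun a => ?_
  congr 1
  ext ⟨i, j⟩
  have hid (t : ℝ) : max t 0 - max (-t) 0 = t := by
    rcases le_total t 0 with h | h <;> simp [h]
  have hmin (s t : ℝ) : min s t = s - max (s - t) 0 := by
    rcases le_total s t with h | h <;> simp [h]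
  by_cases h : 2 * (j : ℕ) + 1 < n <;> simp [S, T, h, hid, hmin]

/-- Row minima of a table with at most `2 ^ k` columns take `k` layers. -/
theorem ScalarNet.relu_iInf {N L : ℕ} {ι : Type} [Fintype ι] [Nonempty ι] {ψ : (ι → ℝ) → ℝ}
    (hψ : ScalarNet (fun t => max t 0) N L ι ψ) (k : ℕ) {n : ℕ} (hn : 0 < n) (hk : n ≤ 2 ^ k)
    (hN : Fintype.card ι * ((3 * n + 1) / 2) ≤ N) :
    ScalarNet (fun t => max t 0) N (L + k) (ι × Fin n) (fun a => ψ fun i => ⨅ j, a (i, j)) := by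
  induction k generalizing n with
  | zero =>
    obtain rfl : n = 1 := by simp at hk; omega
    refine (hψ.comp_affine
      (LinearMap.funLeft ℝ ℝ fun i => ((i, 0) : ι × Fin 1)).toAffineMap).congr fun a => ?_
    congr 1
    ext i
    simp [LinearMap.funLeft]
  | succ k ih =>
    have hN' : Fintype.card ι * ((3 * ((n + 1) / 2) + 1) / 2) ≤ N :=
      (Nat.mul_le_mul_left _ (by omega)).trans hN
    have hnet := (ih (n := (n + 1) / 2) (by omega) (by rw [pow_succ] at hk; omega)
      hN').relu_min_adjacent hn hN
    refine hnet.congr fun a => ?_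
    congr 1
    ext i
    have : Nonempty (Fin n) := ⟨⟨0, hn⟩⟩
    have : Nonempty (Fin ((n + 1) / 2)) := ⟨⟨0, by omega⟩⟩
    refine eq_of_forall_le_iff fun c => ?_
    rw [le_ciInf_iff (Set.finite_range _).bddBelow, le_ciInf_iff (Set.finite_range _).bddBelow]
    constructor
    · intro h j
      dsimp only
      split_ifs
      · exact le_min (h _) (h _)
      · exact h _
    · intro h j
      have hj := h ⟨j / 2, by omega⟩
      dsimp only at hj
      rcases Nat.mod_two_eq_zero_or_one j with h0 | h1
      · have e : (⟨2 * (j / 2), by omega⟩ : Fin n) = j := Fin.ext (by simp; omega)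
        simp only [e] at hj
        split_ifs at hj
        exacts [(le_min_iff.1 hj).1, hj]
      · have e : (⟨2 * (j / 2) + 1, by omega⟩ : Fin n) = j := Fin.ext (by simp; omega)
        rw [dif_pos (by omega)] at hj
        simp only [e] at hj
        exact (le_min_iff.1 hj).2

/-- The max-min of a `q × q` table with `q ≤ 2 ^ k` is a ReLU network of depth `2 * k + 1`. -/
theorem ScalarNet.relu_iSup_iInf {N k q : ℕ} (hq : 0 < q) (hk : q ≤ 2 ^ k)
    (hN : q * ((3 * q + 1) / 2) ≤ N) :
    ScalarNet (fun t => max t 0) N (2 * k + 1) (Fin q × Fin q)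
      (fun a => ⨆ i, ⨅ j, a (i, j)) := by
  have : Nonempty (Fin q) := ⟨⟨0, hq⟩⟩
  have hN1 : (3 * q + 1) / 2 ≤ N := (Nat.le_mul_of_pos_left _ hq).trans hN
  let S : (Unit → ℝ) →ₗ[ℝ] (Bool → ℝ) := LinearMap.pi fun b =>
    (if b then -1 else 1 : ℝ) • LinearMap.proj (φ := fun _ => ℝ) ()
  let T : (Bool → ℝ) →ₗ[ℝ] ℝ :=
    LinearMap.proj (R := ℝ) (φ := fun _ => ℝ) true - LinearMap.proj (φ := fun _ => ℝ) false
  have hneg : ScalarNet (fun t => max t 0) N 1 Unit (fun v => -v ()) := by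
    refine (ScalarNet.layer (κ := Bool) (by simp; omega) S.toAffineMap
      (.affine T.toAffineMap)).congr fun v => ?_
    rcases le_total (v ()) 0 with h | h <;> simp [S, T, h]
  have hmax : ScalarNet (fun t => max t 0) N (1 + k) (Fin q) (fun b => ⨆ i, b i) := by
    refine ((hneg.relu_iInf k hq hk (by simpa using hN1)).comp_affine
      (-LinearMap.funLeft ℝ ℝ Prod.snd).toAffineMap).congr fun b => ?_
    simp only [LinearMap.coe_toAffineMap, LinearMap.neg_apply, LinearMap.funLeft_apply,
      Pi.neg_apply]
    refine eq_of_forall_ge_iff fun c => ?_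
    rw [ciSup_le_iff (Set.finite_range _).bddAbove, neg_le,
      le_ciInf_iff (Set.finite_range _).bddBelow]
    simp
  have h := hmax.relu_iInf k hq hk (by simpa using hN)
  rwa [show 1 + k + k = 2 * k + 1 by ring] at h

/-! ### Replacing ReLU neurons by approximating blocks -/

/-- `IsBlock ρ w s R`: at a cost of `w` neurons per unit in each of `s` additional hidden layers,
the scalar function `R` can be used as an activation function in `ρ`-networks. -/
def IsBlock (ρ : ℝ → ℝ) (w s : ℕ) (R : ℝ → ℝ) : Prop :=
  ∀ (ι : Type) [Fintype ι] [Nonempty ι] (N L : ℕ) (ψ : (ι → ℝ) → ℝ), w * Fintype.card ι ≤ N →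
    ScalarNet ρ N L ι ψ → ScalarNet ρ N (L + s) ι (fun x => ψ fun i => R (x i))

/-- The ReLU function is a uniform limit on compact sets of blocks of width `w` and depth `s`. -/
def ApproxRelu (ρ : ℝ → ℝ) (w s : ℕ) : Prop :=
  ∀ M > 0, ∀ ε > 0, ∃ R, IsBlock ρ w s R ∧ ∀ x, |x| ≤ M → |R x - max x 0| < ε

/-- ReLU units can be replaced by approximating blocks, because the later layers of a ReLU network
are uniformly continuous on bounded sets. -/
theorem ApproxRelu.exists_scalarNet {ρ : ℝ → ℝ} {w s : ℕ} (h : ApproxRelu ρ w s) {N L : ℕ}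
    {ι : Type} [hι : Fintype ι] {φ : (ι → ℝ) → ℝ} (hφ : ScalarNet (fun t => max t 0) N L ι φ)
    (A ε : ℝ) (hε : 0 < ε) :
    ∃ φ', ScalarNet ρ (w * N) (s * L) ι φ' ∧ ∀ x, ‖x‖ ≤ A → |φ' x - φ x| < ε := by
  revert hι
  induction hφ generalizing A ε with
  | affine T => exact ⟨T, .affine T, fun x _ => by simpa using hε⟩
  | @layer L ι κ _ _ hκ T ψ hψ ih =>
    intro _
    obtain ⟨B, hB⟩ := ((isCompact_closedBall (0 : ι → ℝ) A).image
      T.continuous_of_pi).isBounded.exists_norm_le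
    have hB' : ∀ x, ‖x‖ ≤ A → ‖T x‖ ≤ max B 1 := fun x hx =>
      (hB _ ⟨x, by simpa using hx, rfl⟩).trans (le_max_left _ _)
    set C := max B 1
    have hC : 1 ≤ C := le_max_right _ _
    have hψc : Continuous ψ := hψ.continuous (continuous_id.max continuous_const)
    obtain ⟨δ, hδ, huc⟩ := Metric.uniformContinuousOn_iff.1
      ((isCompact_closedBall (0 : κ → ℝ) (C + 1)).uniformContinuousOn_of_continuous
        hψc.continuousOn) (ε / 2) (half_pos hε)
    obtain ⟨ψ', hψ', hψa⟩ := ih (C + 1) (ε / 2) (half_pos hε)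
    obtain ⟨R, hR, hRa⟩ := h C (by linarith) (min δ 1) (by positivity)
    refine ⟨_, (hR κ (w * N) (s * L) ψ' (Nat.mul_le_mul_left w hκ) hψ').comp_affine T,
      fun x hx => ?_⟩
    have hTx := hB' x hx
    have hTk : ∀ k, |T x k| ≤ C := fun k => (norm_le_pi_norm (T x) k).trans hTx
    have hv : ‖fun k => max (T x k) 0‖ ≤ C := by
      refine (pi_norm_le_iff_of_nonneg (by linarith)).2 fun k => ?_
      rw [Real.norm_eq_abs, abs_of_nonneg (le_max_right _ _)]
      exact max_le ((le_abs_self _).trans (hTk k)) (by linarith)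
    have hd : dist (fun k => R (T x k)) (fun k => max (T x k) 0) < min δ 1 :=
      (dist_pi_lt_iff (by positivity)).2 fun k => hRa _ (hTk k)
    have hu : ‖fun k => R (T x k)‖ ≤ C + 1 := by
      have := norm_le_norm_add_norm_sub' (fun k => R (T x k)) (fun k => max (T x k) 0)
      rw [← dist_eq_norm] at this
      have := min_le_right δ 1
      linarith
    have h1 := hψa _ hu
    have h2 := huc _ (by simpa using hu) _ (by simpa using hv.trans (by linarith))
      (hd.trans_le (min_le_left _ _))
    rw [Real.dist_eq] at h2
    calc _ ≤ _ := abs_sub_le _ (ψ fun k => R (T x k)) _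
      _ < ε := by linarith

/-! ### Sums of neurons and one-sided slopes -/

theorem ScalarNet.unitwise_affine {ρ : ℝ → ℝ} {N L : ℕ} {ι α β : Type} [Fintype α]
    {ψ : (ι × β → ℝ) → ℝ} (hψ : ScalarNet ρ N L (ι × β) ψ) (W : β → α → ℝ) (b : β → ℝ) :
    ScalarNet ρ N L (ι × α) (fun x => ψ fun p => ∑ j, W p.2 j * x (p.1, j) + b p.2) := by
  let T : (ι × α → ℝ) →ₗ[ℝ] (ι × β → ℝ) :=
    { toFun := fun x p => ∑ j, W p.2 j * x (p.1, j)
      map_add' := by intro x y; ext p; simp [mul_add, Finset.sum_add_distrib]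
      map_smul' := by intro c x; ext p; simp [Finset.mul_sum, mul_left_comm] }
  exact (hψ.comp_affine (T.toAffineMap + AffineMap.const ℝ _ fun p => b p.2)).congr fun x => rfl

theorem ScalarNet.unitwise_layer {ρ : ℝ → ℝ} {N L : ℕ} {ι α β : Type} [Fintype α] [Fintype β]
    [Nonempty β] [Fintype ι] [Nonempty ι] {ψ : (ι × β → ℝ) → ℝ}
    (hψ : ScalarNet ρ N L (ι × β) ψ) (hN : Fintype.card β * Fintype.card ι ≤ N)
    (W : β → α → ℝ) (b : β → ℝ) :
    ScalarNet ρ N (L + 1) (ι × α)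
      (fun x => ψ fun p => ρ (∑ j, W p.2 j * x (p.1, j) + b p.2)) := by
  have h : ScalarNet ρ N (L + 1) (ι × β) (fun y => ψ fun p => ρ (y p)) :=
    .layer (by rwa [Fintype.card_prod, mul_comm]) (AffineMap.id ℝ _) hψ
  exact h.unitwise_affine W b

theorem IsBlock.mono {ρ R : ℝ → ℝ} {v w s : ℕ} (h : IsBlock ρ v s R) (hvw : v ≤ w) :
    IsBlock ρ w s R :=
  fun ι _ _ N L ψ hN hψ => h ι N L ψ ((Nat.mul_le_mul_right _ hvw).trans hN) hψ

/-- A scalar function realized by one hidden layer of `n` neurons. -/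
def IsNeuronSum (ρ : ℝ → ℝ) (n : ℕ) (G : ℝ → ℝ) : Prop :=
  ∃ (a b c : Fin n → ℝ) (e : ℝ), ∀ x, G x = ∑ k, c k * ρ (a k * x + b k) + e

theorem IsNeuronSum.isBlock {ρ G : ℝ → ℝ} {n : ℕ} (hn : 0 < n) (h : IsNeuronSum ρ n G) :
    IsBlock ρ n 1 G := by
  intro ι _ _ N L ψ hN hψ
  obtain ⟨a, b, c, e, hG⟩ := h
  have : NeZero n := ⟨hn.ne'⟩
  have h1 : ScalarNet ρ N L (ι × Unit) (fun x => ψ fun i => x (i, ())) :=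
    hψ.comp_affine (LinearMap.funLeft ℝ ℝ fun i => (i, ())).toAffineMap
  have h2 := (h1.unitwise_affine (α := Fin n) (fun _ => c) (fun _ => e)).unitwise_layer
    (α := Unit) (by simpa using hN) (fun k _ => a k) b
  refine (h2.comp_affine (LinearMap.funLeft ℝ ℝ (Prod.fst : ι × Unit → ι)).toAffineMap).congr
    fun x => ?_
  simp [hG, LinearMap.funLeft]

theorem isBlock_two_layers {ρ R : ℝ → ℝ} {m n w : ℕ} (hm : 0 < m) (hn : 0 < n) (hmw : m ≤ w)
    (hnw : n ≤ w) (a b : Fin m → ℝ) (W : Fin n → Fin m → ℝ) (f c : Fin n → ℝ) (e : ℝ)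
    (hR : ∀ x, R x = ∑ k, c k * ρ (∑ j, W k j * ρ (a j * x + b j) + f k) + e) :
    IsBlock ρ w 2 R := by
  intro ι _ _ N L ψ hN hψ
  have : NeZero m := ⟨hm.ne'⟩
  have : NeZero n := ⟨hn.ne'⟩
  have h1 : ScalarNet ρ N L (ι × Unit) (fun x => ψ fun i => x (i, ())) :=
    hψ.comp_affine (LinearMap.funLeft ℝ ℝ fun i => (i, ())).toAffineMap
  have h2 := (h1.unitwise_affine (α := Fin n) (fun _ => c) (fun _ => e)).unitwise_layer
    (by simpa using (Nat.mul_le_mul_right _ hnw).trans hN) W f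
  have h3 := h2.unitwise_layer (α := Unit)
    (by simpa using (Nat.mul_le_mul_right _ hmw).trans hN) (fun k _ => a k) b
  refine (h3.comp_affine (LinearMap.funLeft ℝ ℝ (Prod.fst : ι × Unit → ι)).toAffineMap).congr
    fun x => ?_
  simp [hR, LinearMap.funLeft]

theorem IsNeuronSum.add {ρ G H : ℝ → ℝ} {m n : ℕ} (hG : IsNeuronSum ρ m G)
    (hH : IsNeuronSum ρ n H) : IsNeuronSum ρ (m + n) (fun x => G x + H x) := by
  obtain ⟨a, b, c, e, hG⟩ := hG
  obtain ⟨a', b', c', e', hH⟩ := hH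
  refine ⟨Fin.append a a', Fin.append b b', Fin.append c c', e + e', fun x => ?_⟩
  simp only [hG, hH, Fin.sum_univ_add, Fin.append_left, Fin.append_right]
  ring

theorem IsNeuronSum.affine {ρ G : ℝ → ℝ} {n : ℕ} (hG : IsNeuronSum ρ n G) (α β γ η : ℝ) :
    IsNeuronSum ρ n (fun x => α * G (β * x + γ) + η) := by
  obtain ⟨a, b, c, e, hG⟩ := hG
  refine ⟨fun k => a k * β, fun k => a k * γ + b k, fun k => α * c k, α * e + η, fun x => ?_⟩
  simp only [hG, mul_add, Finset.mul_sum, mul_assoc, add_assoc]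

theorem isNeuronSum_self (ρ : ℝ → ℝ) : IsNeuronSum ρ 1 ρ :=
  ⟨fun _ => 1, fun _ => 0, fun _ => 1, 0, fun x => by simp⟩

/-- `F` is a uniform limit on compact sets of sums of `n` neurons. -/
def ApproxNeuronSum (ρ : ℝ → ℝ) (n : ℕ) (F : ℝ → ℝ) : Prop :=
  ∀ M > 0, ∀ ε > 0, ∃ G, IsNeuronSum ρ n G ∧ ∀ x, |x| ≤ M → |G x - F x| < ε

/-- The positively homogeneous function with slope `l` on the left of `0` and `r` on the right. -/
def ramp (l r x : ℝ) : ℝ := l * min x 0 + r * max x 0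

theorem ramp_of_nonneg (l r : ℝ) {x : ℝ} (hx : 0 ≤ x) : ramp l r x = r * x := by
  simp [ramp, hx]

theorem ramp_of_nonpos (l r : ℝ) {x : ℝ} (hx : x ≤ 0) : ramp l r x = l * x := by
  simp [ramp, hx]

theorem ramp_self (c x : ℝ) : ramp c c x = c * x := by
  rw [ramp, ← mul_add, min_add_max, add_zero]

theorem ramp_mul (l r x : ℝ) {δ : ℝ} (hδ : 0 ≤ δ) : ramp l r (δ * x) = δ * ramp l r x := by
  have h1 : min (δ * x) 0 = δ * min x 0 := by rw [mul_min_of_nonneg _ _ hδ, mul_zero]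
  have h2 : max (δ * x) 0 = δ * max x 0 := by rw [mul_max_of_nonneg _ _ hδ, mul_zero]
  rw [ramp, ramp, h1, h2]
  ring

theorem max_eq_ramp {l r : ℝ} (h : l ≠ r) (x : ℝ) :
    max x 0 = (r - l)⁻¹ * (ramp l r x - l * x) := by
  have h' : r - l ≠ 0 := sub_ne_zero.2 h.symm
  rw [← ramp_self l x, ramp, ramp]
  field_simp
  ring

theorem ApproxNeuronSum.approxRelu {ρ : ℝ → ℝ} {m n w : ℕ} {l r : ℝ} (hlr : l ≠ r) (hn : 0 < n)
    (hw : n + m ≤ w) (hr : ApproxNeuronSum ρ n (ramp l r))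
    (hid : ApproxNeuronSum ρ m (fun x => x)) : ApproxRelu ρ w 1 := by
  intro M hM ε hε
  have hc : 0 < |r - l| := abs_pos.2 (sub_ne_zero.2 hlr.symm)
  obtain ⟨G, hG, hGa⟩ := hr M hM (|r - l| * ε / 2) (by positivity)
  obtain ⟨H, hH, hHa⟩ := hid M hM (|r - l| * ε / 2 / (|l| + 1)) (by positivity)
  refine ⟨_, ((((hG.affine 1 1 0 0).add (hH.affine (-l) 1 0 0)).affine (r - l)⁻¹ 1 0 0).isBlock
    (by omega)).mono hw, fun x hx => ?_⟩
  have h1 := hGa x hx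
  have h2 := hHa x hx
  rw [lt_div_iff₀ (by positivity)] at h2
  have h3 : |-l * (H x - x)| ≤ |r - l| * ε / 2 := by
    rw [abs_mul, abs_neg]
    nlinarith [abs_nonneg (H x - x)]
  rw [max_eq_ramp hlr]
  calc _ = |(r - l)⁻¹ * ((G x - ramp l r x) + -l * (H x - x))| := by
        congr 1
        simp only [one_mul, add_zero]
        ring
    _ = |r - l|⁻¹ * |(G x - ramp l r x) + -l * (H x - x)| := by rw [abs_mul, abs_inv]
    _ < |r - l|⁻¹ * (|r - l| * ε) := by
        gcongr
        exact (abs_add_le _ _).trans_lt (by linarith)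
    _ = ε := by field_simp

/-- On a bounded interval the identity is a shifted branch of any nonzero ramp. -/
theorem ApproxNeuronSum.id_of_ramp {ρ : ℝ → ℝ} {n : ℕ} {l r : ℝ} (hlr : l ≠ r)
    (hr : ApproxNeuronSum ρ n (ramp l r)) : ApproxNeuronSum ρ n (fun x => x) := by
  have key : ∃ c σ : ℝ, c ≠ 0 ∧ |σ| = 1 ∧ ∀ M x : ℝ, |x| ≤ M →
      ramp l r (x + σ * M) = c * (x + σ * M) := by
    by_cases h : r = 0
    · refine ⟨l, -1, by rwa [← h], by simp, fun M x hx => ramp_of_nonpos _ _ ?_⟩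
      linarith [(abs_le.1 hx).2]
    · refine ⟨r, 1, h, by simp, fun M x hx => ramp_of_nonneg _ _ ?_⟩
      linarith [(abs_le.1 hx).1]
  obtain ⟨c, σ, hc, hσ, key⟩ := key
  intro M hM ε hε
  have hc' : 0 < |c| := abs_pos.2 hc
  obtain ⟨G, hG, hGa⟩ := hr (M + M) (by positivity) (|c| * ε) (by positivity)
  refine ⟨_, hG.affine c⁻¹ 1 (σ * M) (-(σ * M)), fun x hx => ?_⟩
  have h1 := hGa (x + σ * M) ((abs_add_le _ _).trans (by
    rw [abs_mul, hσ, one_mul, abs_of_pos hM]; linarith))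
  rw [key M x hx] at h1
  calc _ = |c⁻¹ * (G (x + σ * M) - c * (x + σ * M))| := by
        congr 1
        field_simp
        ring_nf
    _ = |c|⁻¹ * |G (x + σ * M) - c * (x + σ * M)| := by rw [abs_mul, abs_inv]
    _ < |c|⁻¹ * (|c| * ε) := by gcongr
    _ = ε := by field_simp

/-- `ramp l r` is the first-order expansion of `g` at `0`. The case `l = r` is differentiability at
`0` with `g 0 = 0`. -/
def HasRamp (g : ℝ → ℝ) (l r : ℝ) : Prop :=
  ∀ η > 0, ∃ τ > 0, ∀ t, |t| < τ → |g t - ramp l r t| ≤ η * |t|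

theorem hasRamp_of_tendsto {f : ℝ → ℝ} {x₀ l r : ℝ}
    (hl : Tendsto (fun t : ℝ => (f (x₀ + t) - f x₀) / t) (𝓝[<] 0) (𝓝 l))
    (hr : Tendsto (fun t : ℝ => (f (x₀ + t) - f x₀) / t) (𝓝[>] 0) (𝓝 r)) :
    HasRamp (fun t => f (x₀ + t) - f x₀) l r := by
  intro η hη
  obtain ⟨τ₁, h₁, H₁⟩ := Metric.mem_nhdsWithin_iff.1 (hl (Metric.closedBall_mem_nhds l hη))
  obtain ⟨τ₂, h₂, H₂⟩ := Metric.mem_nhdsWithin_iff.1 (hr (Metric.closedBall_mem_nhds r hη))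
  have aux (s t : ℝ) (ht : t ≠ 0) (h : dist ((f (x₀ + t) - f x₀) / t) s ≤ η) :
      |f (x₀ + t) - f x₀ - s * t| ≤ η * |t| := by
    rw [Real.dist_eq] at h
    calc _ = |(f (x₀ + t) - f x₀) / t - s| * |t| := by
          rw [← abs_mul]
          congr 1
          field_simp
      _ ≤ _ := by gcongr
  refine ⟨min τ₁ τ₂, lt_min h₁ h₂, fun t ht => ?_⟩
  rcases lt_trichotomy t 0 with h | rfl | h
  · rw [ramp_of_nonpos _ _ h.le]
    exact aux l t h.ne (H₁ ⟨by simpa using ht.trans_le (min_le_left _ _), h⟩)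
  · simp [ramp]
  · rw [ramp_of_nonneg _ _ h.le]
    exact aux r t h.ne' (H₂ ⟨by simpa using ht.trans_le (min_le_right _ _), h⟩)

/-- Zooming in at `0` makes `g` uniformly close to `ramp l r`. The bound `δ * M < τ` keeps the
arguments `δ * x` in a given neighbourhood of `0`. -/
theorem HasRamp.exists_scale {g : ℝ → ℝ} {l r : ℝ} (h : HasRamp g l r) {M ε : ℝ} (hM : 0 < M)
    (hε : 0 < ε) {τ : ℝ} (hτ : 0 < τ) :
    ∃ δ > 0, δ * M < τ ∧ ∀ x, |x| ≤ M → |δ⁻¹ * g (δ * x) - ramp l r x| < ε := by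
  obtain ⟨τ', hτ', H⟩ := h (ε / (2 * M)) (by positivity)
  have hδ : 0 < min τ τ' / (2 * M) := by positivity
  set δ := min τ τ' / (2 * M) with hδd
  have hδM : δ * M < min τ τ' := by
    rw [hδd]
    field_simp
    linarith [lt_min hτ hτ']
  refine ⟨δ, hδ, hδM.trans_le (min_le_left _ _), fun x hx => ?_⟩
  have hx' : |δ * x| ≤ δ * M := by
    rw [abs_mul, abs_of_pos hδ]
    gcongr
  have h1 := H (δ * x) (hx'.trans_lt (hδM.trans_le (min_le_right _ _)))
  rw [ramp_mul _ _ _ hδ.le] at h1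
  calc _ = |δ⁻¹ * (g (δ * x) - δ * ramp l r x)| := by
        congr 1
        field_simp
    _ = δ⁻¹ * |g (δ * x) - δ * ramp l r x| := by rw [abs_mul, abs_of_pos (inv_pos.2 hδ)]
    _ ≤ δ⁻¹ * (ε / (2 * M) * (δ * M)) := by
        gcongr
        exact h1.trans (by gcongr)
    _ = ε / 2 := by field_simp
    _ < ε := by linarith

theorem HasRamp.approxNeuronSum {ρ : ℝ → ℝ} {x₀ l r : ℝ}
    (h : HasRamp (fun t => ρ (x₀ + t) - ρ x₀) l r) : ApproxNeuronSum ρ 1 (ramp l r) := by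
  intro M hM ε hε
  obtain ⟨δ, -, -, H⟩ := h.exists_scale hM hε one_pos
  refine ⟨_, (isNeuronSum_self ρ).affine δ⁻¹ δ x₀ (-(δ⁻¹ * ρ x₀)), fun x hx => ?_⟩
  rw [add_comm (δ * x), ← sub_eq_add_neg, ← mul_sub]
  exact H x hx

theorem HasDerivAt.hasRamp {f : ℝ → ℝ} {c x : ℝ} (h : HasDerivAt f c x) :
    HasRamp (fun t => f (x + t) - f x) c c := by
  have h' := hasDerivAt_iff_tendsto_slope_zero.1 h
  simp only [smul_eq_mul, inv_mul_eq_div] at h'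
  exact hasRamp_of_tendsto (h'.mono_left (nhdsWithin_mono _ fun t ht => ne_of_lt ht))
    (h'.mono_left (nhdsWithin_mono _ fun t ht => ne_of_gt ht))

theorem approxNeuronSum_id {ρ : ℝ → ℝ} {x : ℝ} (h : deriv ρ x ≠ 0) :
    ApproxNeuronSum ρ 1 (fun x => x) := by
  have hd := (differentiableAt_of_deriv_ne_zero h).hasDerivAt.hasRamp.approxNeuronSum
  intro M hM ε hε
  obtain ⟨G, hG, hGa⟩ := hd M hM (|deriv ρ x| * ε) (by positivity)
  refine ⟨_, hG.affine (deriv ρ x)⁻¹ 1 0 0, fun y hy => ?_⟩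
  have h1 := hGa y hy
  rw [ramp_self] at h1
  have hc : 0 < |deriv ρ x| := abs_pos.2 h
  calc _ = |(deriv ρ x)⁻¹ * (G y - deriv ρ x * y)| := by
        congr 1
        field_simp
        simp
    _ = |deriv ρ x|⁻¹ * |G y - deriv ρ x * y| := by rw [abs_mul, abs_inv]
    _ < |deriv ρ x|⁻¹ * (|deriv ρ x| * ε) := by gcongr
    _ = ε := by field_simp

/-! ### The classes of activation functions -/

theorem approxRelu_of_mem_actA1_zero {ρ : ℝ → ℝ} (h : ρ ∈ ActA1 0) : ApproxRelu ρ 3 1 := by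
  obtain ⟨x₀, a, b, -, -, -, l, r, hlr, hl, hr⟩ := h
  simp only [iteratedDeriv_zero] at hl hr
  have hramp := (hasRamp_of_tendsto hl hr).approxNeuronSum
  exact hramp.approxRelu hlr one_pos (by norm_num) (hramp.id_of_ramp hlr)

/-- A kink of `deriv ρ` is seen by difference quotients of `ρ`, which are sums of two neurons. -/
theorem approxNeuronSum_ramp_of_deriv {ρ : ℝ → ℝ} {x₀ a b l r : ℝ} (ha : a < x₀) (hb : x₀ < b)
    (hC : ContDiffOn ℝ 1 ρ (Ioo a b))
    (h : HasRamp (fun t => deriv ρ (x₀ + t) - deriv ρ x₀) l r) :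
    ApproxNeuronSum ρ 2 (ramp l r) := by
  intro M hM ε hε
  have hτ : 0 < min (x₀ - a) (b - x₀) / 2 :=
    half_pos (lt_min (sub_pos.2 ha) (sub_pos.2 hb))
  set τ := min (x₀ - a) (b - x₀) / 2 with hτd
  have hτa : 2 * τ ≤ x₀ - a := by rw [hτd]; linarith [min_le_left (x₀ - a) (b - x₀)]
  have hτb : 2 * τ ≤ b - x₀ := by rw [hτd]; linarith [min_le_right (x₀ - a) (b - x₀)]
  have hsub : Icc (x₀ - 3 / 2 * τ) (x₀ + 3 / 2 * τ) ⊆ Ioo a b := fun x hx =>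
    ⟨by linarith [hx.1], by linarith [hx.2]⟩
  obtain ⟨δ, hδ, hδM, H⟩ := h.exists_scale hM (half_pos hε) hτ
  obtain ⟨s', hs', huc⟩ := Metric.uniformContinuousOn_iff.1
    ((isCompact_Icc (a := x₀ - 3 / 2 * τ) (b := x₀ + 3 / 2 * τ)).uniformContinuousOn_of_continuous
      ((hC.continuousOn_deriv_of_isOpen isOpen_Ioo le_rfl).mono hsub)) (δ * (ε / 2)) (by positivity)
  have hs : 0 < min s' τ / 2 := by positivity
  set s := min s' τ / 2 with hsd
  have hss : s < s' := by rw [hsd]; linarith [min_le_left s' τ]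
  have hsτ : s ≤ τ / 2 := by rw [hsd]; linarith [min_le_right s' τ]
  -- The difference quotient of `ρ` with step `s`, minus `deriv ρ x₀`, divided by the scale `δ`.
  refine ⟨_, (((isNeuronSum_self ρ).affine (δ⁻¹ * s⁻¹) δ (x₀ + s) (-(δ⁻¹ * deriv ρ x₀))).add
    ((isNeuronSum_self ρ).affine (-(δ⁻¹ * s⁻¹)) δ x₀ 0)), fun x hx => ?_⟩
  have hx' : |δ * x| < τ := by
    rw [abs_mul, abs_of_pos hδ]
    exact (mul_le_mul_of_nonneg_left hx hδ.le).trans_lt hδM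
  obtain ⟨hx1, hx2⟩ := abs_lt.1 hx'
  have hseg : Icc (x₀ + δ * x) (x₀ + δ * x + s) ⊆ Icc (x₀ - 3 / 2 * τ) (x₀ + 3 / 2 * τ) :=
    Icc_subset_Icc (by linarith) (by linarith)
  obtain ⟨ξ, hξ, hξe⟩ := exists_deriv_eq_slope ρ (show x₀ + δ * x < x₀ + δ * x + s by linarith)
    (hC.continuousOn.mono (hseg.trans hsub))
    (((hC.differentiableOn one_ne_zero)).mono ((Ioo_subset_Icc_self.trans hseg).trans hsub))
  rw [add_sub_cancel_left] at hξe
  have h1 := huc ξ (hseg (Ioo_subset_Icc_self hξ)) (x₀ + δ * x)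
    (hseg (left_mem_Icc.2 (by linarith))) (by
      rw [Real.dist_eq, abs_of_pos (by linarith [hξ.1])]
      linarith [hξ.2])
  rw [Real.dist_eq] at h1
  calc _ = |δ⁻¹ * (deriv ρ ξ - deriv ρ (x₀ + δ * x)) +
          (δ⁻¹ * (deriv ρ (x₀ + δ * x) - deriv ρ x₀) - ramp l r x)| := by
        rw [hξe, show δ * x + (x₀ + s) = x₀ + δ * x + s by ring, add_comm (δ * x) x₀]
        congr 1
        ring
    _ ≤ δ⁻¹ * |deriv ρ ξ - deriv ρ (x₀ + δ * x)| +
          |δ⁻¹ * (deriv ρ (x₀ + δ * x) - deriv ρ x₀) - ramp l r x| := by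
        refine (abs_add_le _ _).trans_eq ?_
        rw [abs_mul, abs_of_pos (inv_pos.2 hδ)]
    _ < δ⁻¹ * (δ * (ε / 2)) + ε / 2 := by
        gcongr
        exact H x hx
    _ = ε := by field_simp; ring

theorem approxRelu_of_mem_actA1_one {ρ : ℝ → ℝ} (h : ρ ∈ ActA1 1) : ApproxRelu ρ 3 1 := by
  obtain ⟨x₀, a, b, ha, hb, hC, l, r, hlr, hl, hr⟩ := h
  simp only [iteratedDeriv_one] at hl hr
  have hx : ∃ x, deriv ρ x ≠ 0 := by
    by_contra! hx
    simp only [hx, sub_self, zero_div] at hl hr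
    exact hlr ((tendsto_nhds_unique hl tendsto_const_nhds).trans
      (tendsto_nhds_unique hr tendsto_const_nhds).symm)
  obtain ⟨x, hx⟩ := hx
  exact (approxNeuronSum_ramp_of_deriv ha hb hC (hasRamp_of_tendsto hl hr)).approxRelu hlr
    two_pos le_rfl (approxNeuronSum_id hx)

/-- Compressing an S-shaped function `h` gives a step function; multiplication by `x` makes the
convergence uniform near the jump. -/
theorem exists_mul_step_sub_ramp_lt {h : ℝ → ℝ} {B l r : ℝ} (hB : ∀ x, |h x| ≤ B)
    (hl : Tendsto h atBot (𝓝 l)) (hr : Tendsto h atTop (𝓝 r)) {M ε : ℝ} (hM : 0 < M)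
    (hε : 0 < ε) :
    ∃ K₀ > 0, ∀ K ≥ K₀, ∀ x, |x| ≤ M → |x * h (K * x) - ramp l r x| < ε := by
  have hlB : |l| ≤ B := le_of_tendsto' hl.abs hB
  have hrB : |r| ≤ B := le_of_tendsto' hr.abs hB
  have hB0 : 0 ≤ B := (abs_nonneg _).trans (hB 0)
  have hη : 0 < ε / (2 * (B + 1)) := by positivity
  set η := ε / (2 * (B + 1)) with hηd
  have hηB : η * (B + B) < ε := by
    rw [hηd, div_mul_eq_mul_div, div_lt_iff₀ (by positivity)]
    nlinarith
  have hεM : 0 < ε / (2 * M) := by positivity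
  obtain ⟨X₁, H₁⟩ := eventually_atBot.1 (Metric.tendsto_nhds.1 hl _ hεM)
  obtain ⟨X₂, H₂⟩ := eventually_atTop.1 (Metric.tendsto_nhds.1 hr _ hεM)
  have far (s t x : ℝ) (hx : |x| ≤ M) (hst : dist s t < ε / (2 * M)) :
      |x * s - t * x| < ε := by
    rw [Real.dist_eq] at hst
    calc _ = |x| * |s - t| := by rw [← abs_mul]; congr 1; ring
      _ ≤ M * (ε / (2 * M)) := by gcongr
      _ = ε / 2 := by field_simp
      _ < ε := by linarith
  have near (s t x : ℝ) (hx : |x| ≤ η) (hs : |s| ≤ B) (ht : |t| ≤ B) : |x * s - t * x| < ε := by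
    calc _ = |x| * |s - t| := by rw [← abs_mul]; congr 1; ring
      _ ≤ η * (B + B) := by gcongr; exact (abs_sub _ _).trans (add_le_add hs ht)
      _ < ε := hηB
  refine ⟨(|X₁| + |X₂| + 1) / η, by positivity, fun K hK x hx => ?_⟩
  have hK' : |X₁| + |X₂| + 1 ≤ K * η := (div_le_iff₀ hη).1 hK
  have hK0 : 0 < K := lt_of_lt_of_le (by positivity) hK
  rcases le_total |x| η with hxη | hxη
  · rcases le_total x 0 with h0 | h0
    · rw [ramp_of_nonpos _ _ h0]
      exact near _ _ _ hxη (hB _) hlB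
    · rw [ramp_of_nonneg _ _ h0]
      exact near _ _ _ hxη (hB _) hrB
  · have hKx := hK'.trans (mul_le_mul_of_nonneg_left hxη hK0.le)
    rcases le_total x 0 with h0 | h0
    · rw [ramp_of_nonpos _ _ h0]
      rw [abs_of_nonpos h0] at hKx
      exact far _ _ _ hx (H₁ _ (by linarith [neg_abs_le X₁, abs_nonneg X₂]))
    · rw [ramp_of_nonneg _ _ h0]
      rw [abs_of_nonneg h0] at hKx
      exact far _ _ _ hx (H₂ _ (by linarith [le_abs_self X₂, abs_nonneg X₁]))

theorem approxRelu_of_mem_actA2 {ρ : ℝ → ℝ} (h : ρ ∈ ActA2) : ApproxRelu ρ 3 1 := by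
  obtain ⟨b₀, b₁, h, ⟨⟨B, hB⟩, l, r, hlr, hl, hr⟩, hρ⟩ := h
  replace hB : ∀ x, |h x| ≤ B := fun x => hB ⟨x, rfl⟩
  have hB0 : 0 ≤ B := (abs_nonneg _).trans (hB 0)
  have hramp : ApproxNeuronSum ρ 1 (ramp l r) := by
    intro M hM ε hε
    obtain ⟨K₀, hK₀, H⟩ := exists_mul_step_sub_ramp_lt hB hl hr hM (half_pos hε)
    set K := max K₀ (2 * (|b₀| * B) / ε) with hKd
    have hK : 0 < K := hK₀.trans_le (le_max_left _ _)
    have hKb : 2 * (|b₀| * B) ≤ K * ε := (div_le_iff₀ hε).1 (le_max_right _ _)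
    refine ⟨_, (isNeuronSum_self ρ).affine K⁻¹ K 0 (-(K⁻¹ * b₁)), fun x hx => ?_⟩
    have h1 := H K (le_max_left _ _) x hx
    calc _ = |(x * h (K * x) - ramp l r x) + K⁻¹ * (b₀ * h (K * x))| := by
          rw [hρ, add_zero]
          congr 1
          field_simp
          ring
      _ ≤ |x * h (K * x) - ramp l r x| + K⁻¹ * (|b₀| * |h (K * x)|) := by
          refine (abs_add_le _ _).trans_eq ?_
          rw [abs_mul, abs_mul, abs_of_pos (inv_pos.2 hK)]
      _ < ε / 2 + K⁻¹ * (K * ε / 2) := by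
          refine add_lt_add_of_lt_of_le h1 ?_
          gcongr
          nlinarith [hB (K * x), abs_nonneg b₀]
      _ = ε := by field_simp; ring
  exact hramp.approxRelu hlr one_pos (by norm_num) (hramp.id_of_ramp hlr)

/-- Second-order Taylor expansion under the weakest hypotheses, by the mean value inequality. -/
theorem exists_taylor_two {ρ : ℝ → ℝ} {x₀ c : ℝ} (hd : ∀ᶠ x in 𝓝 x₀, DifferentiableAt ℝ ρ x)
    (hc : HasDerivAt (deriv ρ) c x₀) {η : ℝ} (hη : 0 < η) :
    ∃ τ > 0, ∀ t, |t| < τ → |ρ (x₀ + t) - ρ x₀ - deriv ρ x₀ * t - c / 2 * t ^ 2| ≤ η * t ^ 2 := by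
  obtain ⟨τ₁, hτ₁, H₁⟩ := Metric.eventually_nhds_iff.1 hd
  obtain ⟨τ₂, hτ₂, H₂⟩ := hc.hasRamp η hη
  refine ⟨min τ₁ τ₂, lt_min hτ₁ hτ₂, fun t ht => ?_⟩
  have hder : ∀ u ∈ Icc (-|t|) |t|, HasDerivWithinAt
      (fun u => ρ (x₀ + u) - ρ x₀ - deriv ρ x₀ * u - c / 2 * u ^ 2)
      (deriv ρ (x₀ + u) - deriv ρ x₀ - c * u) (Icc (-|t|) |t|) u := by
    intro u hu
    have hu' : |u| < τ₁ := (abs_le.2 hu).trans_lt (ht.trans_le (min_le_left _ _))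
    have h1 := (H₁ (y := x₀ + u) (by simpa using hu')).hasDerivAt.comp_const_add x₀ u
    have h2 := (((h1.sub_const (ρ x₀)).sub ((hasDerivAt_id u).const_mul (deriv ρ x₀))).sub
      (((hasDerivAt_id u).pow 2).const_mul (c / 2))).hasDerivWithinAt (s := Icc (-|t|) |t|)
    refine h2.congr_deriv ?_
    norm_num
    ring
  have hbd : ∀ u ∈ Icc (-|t|) |t|, ‖deriv ρ (x₀ + u) - deriv ρ x₀ - c * u‖ ≤ η * |t| := by
    intro u hu
    have hu' := abs_le.2 hu
    have := H₂ u (hu'.trans_lt (ht.trans_le (min_le_right _ _)))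
    rw [ramp_self] at this
    exact this.trans (by gcongr)
  have := Convex.norm_image_sub_le_of_norm_hasDerivWithin_le hder hbd (convex_Icc _ _)
    (show (0 : ℝ) ∈ Icc (-|t|) |t| by simp) (abs_le.1 le_rfl)
  simp only [add_zero, sub_self, mul_zero, ne_eq, OfNat.ofNat_ne_zero, not_false_eq_true, zero_pow,
    sub_zero, Real.norm_eq_abs, mul_assoc, abs_mul_abs_self] at this
  rw [pow_two]
  simpa [pow_two, mul_assoc] using this

/-- A point where `ρ'' = c` is nonzero makes mixed second differences of `ρ` approximate products,
with three neurons. -/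
theorem exists_mul_approx {ρ : ℝ → ℝ} {x₀ c : ℝ} (hc0 : c ≠ 0)
    (hd : ∀ᶠ x in 𝓝 x₀, DifferentiableAt ℝ ρ x) (hc : HasDerivAt (deriv ρ) c x₀) {U ε : ℝ}
    (hU : 0 < U) (hε : 0 < ε) :
    ∃ δ > 0, ∀ u v, |u| ≤ U → |v| ≤ U →
      |(δ ^ 2 * c)⁻¹ * (ρ (x₀ + δ * (u + v)) - ρ (x₀ + δ * u) - ρ (x₀ + δ * v) + ρ x₀) - u * v|
        < ε := by
  have hc' : 0 < |c| := abs_pos.2 hc0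
  obtain ⟨τ, hτ, H⟩ := exists_taylor_two hd hc (η := ε * |c| / (12 * U ^ 2)) (by positivity)
  set η := ε * |c| / (12 * U ^ 2) with hη
  have hδ : 0 < τ / (4 * U) := by positivity
  set δ := τ / (4 * U) with hδd
  have hδU : δ * (2 * U) < τ := by
    rw [hδd]
    field_simp
    linarith
  refine ⟨δ, hδ, fun u v hu hv => ?_⟩
  have E (w : ℝ) (k : ℝ) (hk : k ≤ 2) (hk0 : 0 ≤ k) (hw : |w| ≤ k * U) :
      |ρ (x₀ + δ * w) - ρ x₀ - deriv ρ x₀ * (δ * w) - c / 2 * (δ * w) ^ 2|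
        ≤ η * (δ * (k * U)) ^ 2 := by
    have hw' : |δ * w| ≤ δ * (k * U) := by
      rw [abs_mul, abs_of_pos hδ]
      gcongr
    refine (H _ (hw'.trans_lt (lt_of_le_of_lt (by gcongr) hδU))).trans ?_
    rw [← sq_abs (δ * w)]
    gcongr
  have E1 := E (u + v) 2 le_rfl (by norm_num) ((abs_add_le _ _).trans (by linarith))
  have E2 := E u 1 (by norm_num) (by norm_num) (by linarith)
  have E3 := E v 1 (by norm_num) (by norm_num) (by linarith)
  set e1 := ρ (x₀ + δ * (u + v)) - ρ x₀ - deriv ρ x₀ * (δ * (u + v)) - c / 2 * (δ * (u + v)) ^ 2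
    with he1
  set e2 := ρ (x₀ + δ * u) - ρ x₀ - deriv ρ x₀ * (δ * u) - c / 2 * (δ * u) ^ 2 with he2
  set e3 := ρ (x₀ + δ * v) - ρ x₀ - deriv ρ x₀ * (δ * v) - c / 2 * (δ * v) ^ 2 with he3
  calc _ = |(δ ^ 2 * c)⁻¹ * (e1 - e2 - e3)| := by
        congr 1
        rw [he1, he2, he3]
        field_simp
        ring
    _ = (δ ^ 2 * |c|)⁻¹ * |e1 - e2 - e3| := by
        rw [abs_mul, abs_inv, abs_mul, abs_of_pos (pow_pos hδ 2)]
    _ ≤ (δ ^ 2 * |c|)⁻¹ * (6 * (η * (δ * U) ^ 2)) := by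
        gcongr
        have h1 := abs_sub (e1 - e2) e3
        have h2 := abs_sub e1 e2
        nlinarith
    _ = ε / 2 := by
        rw [hη]
        field_simp
        norm_num
    _ < ε := by linarith

/-- `max x 0` is the product of `x` and a step function: one layer computes both factors and a
second layer multiplies them. -/
theorem approxRelu_of_mem_actA3 {ρ : ℝ → ℝ} (h : ρ ∈ ActA3) : ApproxRelu ρ 3 2 := by
  obtain ⟨⟨⟨B, hB⟩, l, r, hlr, hl, hr⟩, x₀, hd, hc0⟩ := h
  replace hB : ∀ x, |ρ x| ≤ B := fun x => hB ⟨x, rfl⟩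
  have hB0 : 0 ≤ B := (abs_nonneg _).trans (hB 0)
  have hc := (differentiableAt_of_deriv_ne_zero hc0).hasDerivAt
  set c := deriv (deriv ρ) x₀ with hcd
  have hx : ∃ x, deriv ρ x ≠ 0 := by
    by_contra! hx
    exact hc0 (by rw [hcd, funext hx, deriv_const])
  obtain ⟨x₁, hx₁⟩ := hx
  have hrl : r - l ≠ 0 := sub_ne_zero.2 hlr.symm
  have hrl' : 0 < |r - l| := abs_pos.2 hrl
  -- `(r - l)⁻¹ * (ρ x - l)` is the normalization of `ρ` with limits `0` and `1`, bounded by `V`.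
  set V := |r - l|⁻¹ * (B + |l|) with hV
  have hV0 : 0 ≤ V := by positivity
  have hstep : ∀ x, |(r - l)⁻¹ * (ρ x - l)| ≤ V := fun x => by
    rw [abs_mul, abs_inv, hV]
    gcongr
    exact (abs_sub _ _).trans (by linarith [hB x])
  have hstepl : Tendsto (fun x => (r - l)⁻¹ * (ρ x - l)) atBot (𝓝 0) := by
    simpa using (hl.sub_const l).const_mul (r - l)⁻¹
  have hstepr : Tendsto (fun x => (r - l)⁻¹ * (ρ x - l)) atTop (𝓝 1) := by
    simpa [hrl] using (hr.sub_const l).const_mul (r - l)⁻¹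
  intro M hM ε hε
  obtain ⟨K, hK, HK⟩ := exists_mul_step_sub_ramp_lt hstep hstepl hstepr hM
    (show 0 < ε / 3 by positivity)
  obtain ⟨δ, hδ, Hδ⟩ := exists_mul_approx hc0 hd hc (show 0 < M + 1 + V by positivity)
    (show 0 < ε / 3 by positivity)
  obtain ⟨G, ⟨a, b, α, e, hG⟩, hGa⟩ := approxNeuronSum_id hx₁ M hM
    (min 1 (ε / 3 / (V + 1))) (by positivity)
  refine ⟨fun x => (δ ^ 2 * c)⁻¹ * (ρ (x₀ + δ * (G x + (r - l)⁻¹ * (ρ (K * x) - l))) -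
      ρ (x₀ + δ * G x) - ρ (x₀ + δ * ((r - l)⁻¹ * (ρ (K * x) - l))) + ρ x₀),
    isBlock_two_layers (m := 2) (n := 3) two_pos three_pos (by norm_num) le_rfl ![a 0, K] ![b 0, 0]
      ![![δ * α 0, δ * (r - l)⁻¹], ![δ * α 0, 0], ![0, δ * (r - l)⁻¹]]
      ![x₀ + δ * e - δ * (r - l)⁻¹ * l, x₀ + δ * e, x₀ - δ * (r - l)⁻¹ * l]
      ![(δ ^ 2 * c)⁻¹, -(δ ^ 2 * c)⁻¹, -(δ ^ 2 * c)⁻¹] ((δ ^ 2 * c)⁻¹ * ρ x₀) fun x => ?_,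
    fun x hx => ?_⟩
  · simp only [hG, Fin.sum_univ_succ, Fin.sum_univ_zero]
    simp
    ring_nf
  · have h1 := hGa x hx
    have h1a := h1.trans_le (min_le_left _ _)
    have h1b := h1.trans_le (min_le_right _ _)
    rw [lt_div_iff₀ (by positivity)] at h1b
    have hGx : |G x| ≤ M + 1 + V := by
      have := abs_sub_abs_le_abs_sub (G x) x
      linarith
    have h2 := Hδ (G x) _ hGx ((hstep (K * x)).trans (by linarith))
    have h3 := HK K le_rfl x hx
    have hv := hstep (K * x)
    set v := (r - l)⁻¹ * (ρ (K * x) - l)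
    rw [show ramp 0 1 x = max x 0 by simp [ramp]] at h3
    have h4 : |(G x - x) * v| < ε / 3 := by
      rw [abs_mul]
      nlinarith [abs_nonneg (G x - x)]
    rw [abs_lt] at h2 h3 h4 ⊢
    constructor <;> nlinarith

theorem exists_approxRelu {ρ : ℝ → ℝ} (h : ρ ∈ ActA) : ∃ s, 1 ≤ s ∧ s ≤ 2 ∧ ApproxRelu ρ 3 s := by
  rcases h with ((h | h) | h) | h
  · exact ⟨1, le_rfl, one_le_two, approxRelu_of_mem_actA1_zero h⟩
  · exact ⟨1, le_rfl, one_le_two, approxRelu_of_mem_actA1_one h⟩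
  · exact ⟨1, le_rfl, one_le_two, approxRelu_of_mem_actA2 h⟩
  · exact ⟨2, one_le_two, le_rfl, approxRelu_of_mem_actA3 h⟩

/-! ### Piecewise linear functions as max-min functions -/

/-- Two continuous affine functions which agree on the intersection of two compact convex sets can
be separated, up to `ε`, by one affine function: their graphs over the two sets, moved apart
vertically, are separated by a hyperplane. If the hyperplane is vertical, a steep affine function
that changes sign across it does the job. -/
theorem exists_affine_between {d : ℕ} {X Y : Set (Fin d → ℝ)} (hX : Convex ℝ X)
    (hXc : IsCompact X) (hY : Convex ℝ Y) (hYc : IsCompact Y) (g k : (Fin d → ℝ) →ᵃ[ℝ] ℝ)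
    (hgk : ∀ x ∈ X ∩ Y, g x = k x) {ε : ℝ} (hε : 0 < ε) :
    ∃ h : (Fin d → ℝ) →ᵃ[ℝ] ℝ, (∀ x ∈ X, g x - ε ≤ h x) ∧ ∀ x ∈ Y, h x ≤ k x + ε := by
  have hg := g.continuous_of_pi
  have hk := k.continuous_of_pi
  let P : Set ((Fin d → ℝ) × ℝ) := (fun x => (x, g x - ε)) '' X
  let Q : Set ((Fin d → ℝ) × ℝ) := {p | p.1 ∈ Y ∧ k p.1 + ε ≤ p.2}
  have comb (g : (Fin d → ℝ) →ᵃ[ℝ] ℝ) {x y : Fin d → ℝ} {a b : ℝ} (hab : a + b = 1) :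
      g (a • x + b • y) = a * g x + b * g y := by
    simpa using Convex.combo_affine_apply hab (f := g) (x := x) (y := y)
  have hP : Convex ℝ P := by
    rintro _ ⟨x, hx, rfl⟩ _ ⟨y, hy, rfl⟩ a b ha hb hab
    refine ⟨a • x + b • y, hX hx hy ha hb hab, ?_⟩
    simp only [Prod.smul_mk, Prod.mk_add_mk, smul_eq_mul, comb g hab]
    congr 1
    linear_combination ε * hab
  have hQ : Convex ℝ Q := by
    rintro ⟨x, s⟩ ⟨hx, hs⟩ ⟨y, t⟩ ⟨hy, ht⟩ a b ha hb hab
    refine ⟨hY hx hy ha hb hab, ?_⟩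
    simp only [Prod.smul_mk, Prod.mk_add_mk, smul_eq_mul, comb k hab] at *
    have h1 := mul_le_mul_of_nonneg_left hs ha
    have h2 := mul_le_mul_of_nonneg_left ht hb
    linear_combination h1 + h2 - ε * hab
  have hPc : IsCompact P := hXc.image (continuous_id.prodMk (hg.sub continuous_const))
  have hQc : IsClosed Q := (hYc.isClosed.preimage continuous_fst).inter
    (isClosed_le ((hk.comp continuous_fst).add continuous_const) continuous_snd)
  have hdisj : Disjoint P Q := by
    rw [Set.disjoint_left]
    rintro _ ⟨x, hx, rfl⟩ ⟨hy, h⟩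
    have := hgk x ⟨hx, hy⟩
    simp only at h
    linarith
  obtain ⟨F, u, v, hFP, huv, hFQ⟩ := geometric_hahn_banach_compact_closed hP hPc hQ hQc hdisj
  let φ : (Fin d → ℝ) →ₗ[ℝ] ℝ := F.toLinearMap ∘ₗ LinearMap.inl ℝ _ _
  set α := F (0, 1) with hα
  have hF (x : Fin d → ℝ) (t : ℝ) : F (x, t) = φ x + t * α := by
    have : (x, t) = (x, (0 : ℝ)) + t • ((0 : Fin d → ℝ), (1 : ℝ)) := by simp
    rw [this, map_add, map_smul]
    rfl
  have hX' : ∀ x ∈ X, φ x + (g x - ε) * α < u := fun x hx => hF x _ ▸ hFP _ ⟨x, hx, rfl⟩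
  have hY' : ∀ x ∈ Y, ∀ s ≥ 0, v < φ x + (k x + ε + s) * α := fun x hx s hs =>
    hF x _ ▸ hFQ (x, k x + ε + s) ⟨hx, by simpa using hs⟩
  rcases lt_trichotomy α 0 with h | h | h
  · -- `Q` is unbounded upwards, so a negative slope leaves no room for a point of `Y`.
    refine ⟨g, fun x _ => by linarith, fun x hx => ?_⟩
    exfalso
    have h1 := hY' x hx (|φ x + (k x + ε) * α - v| / -α) (div_nonneg (abs_nonneg _) (by linarith))
    rw [add_mul, div_mul_eq_mul_div, div_neg, mul_div_cancel_right₀ _ h.ne] at h1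
    linarith [le_abs_self (φ x + (k x + ε) * α - v)]
  · -- A vertical hyperplane separates `X` from `Y` strictly; `K` is the slope across it.
    simp only [h, mul_zero, add_zero] at hX' hY'
    obtain ⟨B, hB⟩ := (hXc.image hg).isBounded.exists_norm_le
    obtain ⟨C, hC⟩ := (hYc.image hk).isBounded.exists_norm_le
    have hvu : 0 < v - u := by linarith
    set K := (|B| + |C|) * 2 / (v - u) with hK
    have hK0 : 0 ≤ K := by positivity
    have hKe : K * ((v - u) / 2) = |B| + |C| := by
      rw [hK]
      field_simp
    refine ⟨AffineMap.const ℝ _ (K * ((u + v) / 2)) - (K • φ).toAffineMap,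
      fun x hx => ?_, fun x hx => ?_⟩
    · have h1 : ‖g x‖ ≤ B := hB _ ⟨x, hx, rfl⟩
      have h2 : K * ((v - u) / 2) ≤ K * ((u + v) / 2 - φ x) :=
        mul_le_mul_of_nonneg_left (by linarith [hX' x hx]) hK0
      change _ ≤ K * ((u + v) / 2) - K * φ x
      linarith [le_abs_self (g x), Real.norm_eq_abs (g x), le_abs_self B, abs_nonneg C]
    · have h1 : ‖k x‖ ≤ C := hC _ ⟨x, hx, rfl⟩
      have h2 : K * ((v - u) / 2) ≤ K * (φ x - (u + v) / 2) :=
        mul_le_mul_of_nonneg_left (by linarith [hY' x hx 0 le_rfl]) hK0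
      change K * ((u + v) / 2) - K * φ x ≤ _
      linarith [neg_abs_le (k x), Real.norm_eq_abs (k x), le_abs_self C, abs_nonneg B]
  · refine ⟨AffineMap.const ℝ _ (α⁻¹ * u) - (α⁻¹ • φ).toAffineMap, fun x hx => ?_, fun x hx => ?_⟩
    · change _ ≤ α⁻¹ * u - α⁻¹ * φ x
      rw [← mul_sub, inv_mul_eq_div, le_div_iff₀ h]
      linarith [hX' x hx]
    · change α⁻¹ * u - α⁻¹ * φ x ≤ _
      rw [← mul_sub, inv_mul_eq_div, div_le_iff₀ h]
      have := hY' x hx 0 le_rfl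
      rw [add_zero] at this
      linarith

/-- On a compact convex set, a piecewise linear function with `q` convex pieces is up to `ε` the
max-min of a `q × q` table of affine functions. -/
theorem IsCPWL.exists_iSup_iInf {d q : ℕ} {f : (Fin d → ℝ) → ℝ} (hf : IsCPWL f q) (hq : 0 < q)
    {S : Set (Fin d → ℝ)} (hS : Convex ℝ S) (hSc : IsCompact S) {ε : ℝ} (hε : 0 < ε) :
    ∃ h : Fin q → Fin q → (Fin d → ℝ) →ᵃ[ℝ] ℝ,
      ∀ x ∈ S, |(⨆ i, ⨅ j, h i j x) - f x| ≤ ε := by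
  obtain ⟨-, X, hXu, hX⟩ := hf
  choose hXcl hXcv g hg using hX
  have hne : Nonempty (Fin q) := ⟨⟨0, hq⟩⟩
  have key (i j : Fin q) := exists_affine_between ((hXcv i).inter hS) (hSc.inter_left (hXcl i))
    ((hXcv j).inter hS) (hSc.inter_left (hXcl j)) (g i) (g j)
    (fun x hx => (hg i hx.1.1).symm.trans (hg j hx.2.1)) hε
  choose h hlow hupp using key
  refine ⟨h, fun x hx => ?_⟩
  obtain ⟨i, hi⟩ := mem_iUnion.1 (hXu ▸ mem_univ x)
  rw [abs_le]
  constructor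
  · have h1 : f x - ε ≤ ⨅ j, h i j x :=
      le_ciInf fun j => (hg i hi).symm ▸ hlow i j x ⟨hi, hx⟩
    have h2 := le_ciSup (f := fun i => ⨅ j, h i j x) (Set.finite_range _).bddAbove i
    linarith
  · have h1 : (⨆ i', ⨅ j, h i' j x) ≤ f x + ε := ciSup_le fun i' =>
      (ciInf_le (Set.finite_range _).bddBelow i).trans ((hg i hi).symm ▸ hupp i' i x ⟨hi, hx⟩)
    linarith

theorem corollary1p4 (ρ : ℝ → ℝ) (hρ : ρ ∈ ActA) (d q : ℕ) (hd : 0 < d) (hq : 0 < q)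
    (f : (Fin d → ℝ) → ℝ) (hf : IsCPWL f q) (ε A : ℝ) (hε : 0 < ε) (hA : 0 < A) :
    ∃ φ ∈ NNet ρ (3 * ⌈(3 * (q : ℝ)) / 2⌉₊ * q) (4 * ⌈Real.logb 2 (q : ℝ)⌉₊ + 2) d 1,
      ∀ x : Fin d → ℝ, (∀ i, x i ∈ Set.Icc (-A) A) → |φ x 0 - f x| < ε := by
  obtain ⟨s, hs1, hs2, hs⟩ := exists_approxRelu hρ
  set k := ⌈Real.logb 2 (q : ℝ)⌉₊ with hk
  have hqk : q ≤ 2 ^ k := by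
    rw [hk, show Real.logb 2 (q : ℝ) = Real.logb (2 : ℕ) q by norm_num, Real.natCeil_logb_natCast]
    exact Nat.le_pow_clog one_lt_two q
  have hN : q * ((3 * q + 1) / 2) ≤ ⌈(3 * (q : ℝ)) / 2⌉₊ * q := by
    rw [mul_comm]
    refine Nat.mul_le_mul_right _ ?_
    have h1 := (div_le_iff₀ two_pos).1 (Nat.le_ceil ((3 * (q : ℝ)) / 2))
    have h2 : 3 * q ≤ ⌈(3 * (q : ℝ)) / 2⌉₊ * 2 := by exact_mod_cast h1
    omega
  obtain ⟨h, hh⟩ := hf.exists_iSup_iInf hq (convex_closedBall (0 : Fin d → ℝ) A)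
    (isCompact_closedBall _ _) (half_pos hε)
  have hnet := (ScalarNet.relu_iSup_iInf hq hqk hN).comp_affine (ι := Fin d)
    (AffineMap.pi fun p => h p.1 p.2)
  obtain ⟨φ, hφ, hφa⟩ := hs.exists_scalarNet hnet A (ε / 2) (half_pos hε)
  rw [← mul_assoc] at hφ
  refine ⟨fun x _ => φ x, ⟨s * (2 * k + 1), ?_, ?_, hφ.isRealized (Equiv.refl _)⟩, fun x hx => ?_⟩
  · exact Nat.mul_pos hs1 (by omega)
  · calc s * (2 * k + 1) ≤ 2 * (2 * k + 1) := Nat.mul_le_mul_right _ hs2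
      _ = 4 * k + 2 := by ring
  · have hx' : ‖x‖ ≤ A := (pi_norm_le_iff_of_nonneg hA.le).2 fun i => abs_le.2 (hx i)
    have h1 := hφa x hx'
    have h2 := hh x (by simpa using hx')
    calc _ ≤ _ := abs_sub_le _ (⨆ i, ⨅ j, h i j x) _
      _ < ε / 2 + ε / 2 := add_lt_add_of_lt_of_le h1 h2
      _ = ε := add_halves ε
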